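/- Let $(M,\phi,\xi,\eta,g)$ be a $(2n+1)$-dimensional Kenmotsu manifold, i.e. $M$ is a smooth manifold of dimension $2n+1$, $g$ a Riemannian metric with Levi-Civita connection $\nabla$, $\phi$ a $(1,1)$-tensor field, $\xi$ a vector field and $\eta$ a $1$-form (all smooth) such that $$\phi^2=-I+\eta\otimes\xi,\quad \eta(\xi)=1,\quad \eta=g(\xi,\cdot),\quad g(\phi X,\phi Y)=g(X,Y)-\eta(X)\eta(Y),\quad (\nabla_X\phi)Y=g(\phi X,Y)\xi-\eta(Y)\phi X$$ for all smooth vector fields $X,Y$. Let $a>0$ be a constant and let $$\overline{\phi}=\phi,\quad \overline{\xi}=\tfrac1a\xi,\quad \overline{\eta}=a\eta,\quad \overline{g}=ag+a(a-1)\eta\otimes\eta$$ be the $D$-homothetically deformed structure. Let $f$ and $\overline{\lambda}$ be smooth functions on $M$ such that $V=\overline{\mathrm{grad}}(f)$, the gradient of $f$ with respect to $\overline{g}$, and $\overline{\lambda}$ define a gradient almost Ricci soliton on $(M,\overline{g})$, i.e. $$\tfrac12\mathcal{L}_V\overline{g}+\overline{\mathrm{Ric}}=\overline{\lambda}\,\overline{g},$$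 where $\overline{\mathrm{Ric}}$ is the Ricci tensor of $\overline{g}$. Then at every point of $M$ $$\begin{aligned} |\mathrm{Ric}|_g^2\ \geq\ & |\mathrm{Hess}(f)|_g^2-4n\frac{a-1}{a}\,\mathrm{scal}-4n^2(2n+1)\Big(\frac{a-1}{a}\Big)^2-\frac{1}{2n+1}(\Delta(f))^2\\ &-\frac{2}{2n+1}\,\frac{a-1}{a}\,[\xi(f)-\xi(\xi(f))]\,\Delta(f)+\frac{2(2n+a)(a-1)}{(2n+1)a^2}\,\xi(f)\,\xi(\xi(f))\\ &+\frac{2n}{2n+1}\Big(\frac{a-1}{a}\Big)^2(\xi(f))^2-\frac{2(n+na+a)(a-1)}{(2n+1)a^2}\,(\xi(\xi(f)))^2, \end{aligned}$$ where $\mathrm{Ric}$, $\mathrm{scal}$, $\mathrm{Hess}$ and $\Delta=\mathrm{div}\circ\mathrm{grad}$ are the Ricci tensor, the scalar curvature, the Hessian and the Laplacian of the original metric $g$, and $|\cdot|_g$ is the Hilbert-Schmidt norm with respect to $g$. -/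

import Mathlib

theorem Kenmotsu.contDiff_smulRight_self (E : Type*) [NormedAddCommGroup E] [NormedSpace ℝ E] :
    ContDiff ℝ (⊤ : ℕ∞) (fun α : E →L[ℝ] ℝ ↦ α.smulRight α) :=
  ContDiff.comp (g := fun p : (E →L[ℝ] ℝ) × (E →L[ℝ] ℝ) ↦ p.1.smulRight p.2)
    isBoundedBilinearMap_smulRight.contDiff (contDiff_id.prodMk contDiff_id)

open Bundle Module Set FiberBundle VectorField
open scoped Manifold ContDiff Topology

noncomputable section

namespace Kenmotsu

section Riemannian

variable {E : Type*} [NormedAddCommGroup E] [NormedSpace ℝ E] [FiniteDimensional ℝ E]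
  {M : Type*} [TopologicalSpace M] [ChartedSpace E M] [IsManifold 𝓘(ℝ, E) ∞ M]

/-- Smooth Riemannian metrics on `M`. -/
abbrev Metric (E : Type*) [NormedAddCommGroup E] [NormedSpace ℝ E] [FiniteDimensional ℝ E]
    (M : Type*) [TopologicalSpace M] [ChartedSpace E M] [IsManifold 𝓘(ℝ, E) ∞ M] :=
  ContMDiffRiemannianMetric 𝓘(ℝ, E) ∞ E (fun x : M ↦ TangentSpace 𝓘(ℝ, E) x)

/-- Vector fields on `M` (smoothness is a separate hypothesis, see `IsSmooth`). -/
abbrev VField (E : Type*) [NormedAddCommGroup E] [NormedSpace ℝ E]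
    (M : Type*) [TopologicalSpace M] [ChartedSpace E M] :=
  Π x : M, TangentSpace 𝓘(ℝ, E) x

/-- The vector field `X` is smooth. -/
def IsSmooth (X : VField E M) : Prop :=
  ContMDiff 𝓘(ℝ, E) 𝓘(ℝ, E).tangent ∞ (fun x ↦ (X x : TangentBundle 𝓘(ℝ, E) M))

/-- The vector field `X` is differentiable at `x`. -/
abbrev DiffAt (X : VField E M) (x : M) : Prop :=
  MDifferentiableAt 𝓘(ℝ, E) 𝓘(ℝ, E).tangent (fun x ↦ (X x : TangentBundle 𝓘(ℝ, E) M)) x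

theorem mdifferentiableAt_inner (g : Metric E M) {X Y : VField E M} {x : M}
    (hX : DiffAt X x) (hY : DiffAt Y x) :
    MDifferentiableAt 𝓘(ℝ, E) 𝓘(ℝ, ℝ) (fun y ↦ g.inner y (X y) (Y y)) x := by
  let _ : RiemannianBundle (fun x : M ↦ TangentSpace 𝓘(ℝ, E) x) := ⟨g.toRiemannianMetric⟩
  exact MDifferentiableAt.inner_bundle (F := E) (E := fun x : M ↦ TangentSpace 𝓘(ℝ, E) x) hX hY

theorem exists_orthonormal (g : Metric E M) (x : M) :
    ∃ e : Basis (Fin (finrank ℝ E)) ℝ (TangentSpace 𝓘(ℝ, E) x),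
      ∀ i j, g.inner x (e i) (e j) = if i = j then 1 else 0 := by
  let _ : RiemannianBundle (fun x : M ↦ TangentSpace 𝓘(ℝ, E) x) := ⟨g.toRiemannianMetric⟩
  have : FiniteDimensional ℝ (TangentSpace 𝓘(ℝ, E) x) := inferInstanceAs (FiniteDimensional ℝ E)
  let b := stdOrthonormalBasis ℝ (TangentSpace 𝓘(ℝ, E) x)
  have h : ∀ i j, inner ℝ (b.toBasis i) (b.toBasis j) = if i = j then (1 : ℝ) else 0 := fun i j ↦ by
    simpa using orthonormal_iff_ite.1 b.orthonormal i j
  exact ⟨b.toBasis, h⟩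

/-- A `g`-orthonormal basis of the tangent space at `x`. -/
def frame (g : Metric E M) (x : M) : Basis (Fin (finrank ℝ E)) ℝ (TangentSpace 𝓘(ℝ, E) x) :=
  (exists_orthonormal g x).choose

theorem inner_frame (g : Metric E M) (x : M) (i j : Fin (finrank ℝ E)) :
    g.inner x (frame g x i) (frame g x j) = if i = j then 1 else 0 :=
  (exists_orthonormal g x).choose_spec i j

/-- The vector `g`-dual to a covector. -/
def sharp (g : Metric E M) (x : M) :
    (TangentSpace 𝓘(ℝ, E) x →L[ℝ] ℝ) →ₗ[ℝ] TangentSpace 𝓘(ℝ, E) x where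
  toFun α := ∑ i, α (frame g x i) • frame g x i
  map_add' α β := by simp [add_smul, Finset.sum_add_distrib]
  map_smul' c α := by simp [mul_smul, Finset.smul_sum]

theorem inner_sharp (g : Metric E M) (x : M) (α : TangentSpace 𝓘(ℝ, E) x →L[ℝ] ℝ)
    (v : TangentSpace 𝓘(ℝ, E) x) : g.inner x (sharp g x α) v = α v := by
  have h : (g.inner x (sharp g x α) : TangentSpace 𝓘(ℝ, E) x →ₗ[ℝ] ℝ) = α := by
    refine (frame g x).ext fun j ↦ ?_
    simp [sharp, inner_frame]
  exact congrArg (fun l : TangentSpace 𝓘(ℝ, E) x →ₗ[ℝ] ℝ ↦ l v) h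

/-- The right-hand side of the Koszul formula, i.e. `2 g(∇_X Y, Z)`. -/
def koszul (g : Metric E M) (X Y Z : VField E M) (x : M) : ℝ :=
  d% (fun y ↦ g.inner y (Y y) (Z y)) x (X x) + d% (fun y ↦ g.inner y (X y) (Z y)) x (Y x)
    - d% (fun y ↦ g.inner y (X y) (Y y)) x (Z x)
    + g.inner x (mlieBracket 𝓘(ℝ, E) X Y x) (Z x)
    - g.inner x (mlieBracket 𝓘(ℝ, E) X Z x) (Y x)
    - g.inner x (mlieBracket 𝓘(ℝ, E) Y Z x) (X x)

theorem koszul_tensorial_left (g : Metric E M) {Y : VField E M} {x : M} (hY : DiffAt Y x)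
    (Z : VField E M) (hZ : DiffAt Z x) :
    TensorialAt 𝓘(ℝ, E) E (fun X : VField E M ↦ koszul g X Y Z x) x where
  smul {f X} hf hX := by
    simp [koszul, mlieBracket_smul_left hf hX,
      mvfderiv_fun_mul hf (mdifferentiableAt_inner g hX hZ),
      mvfderiv_fun_mul hf (mdifferentiableAt_inner g hX hY)]
    ring
  add {X X'} hX hX' := by
    simp [koszul, mlieBracket_add_left hX hX',
      mvfderiv_fun_add (mdifferentiableAt_inner g hX hZ) (mdifferentiableAt_inner g hX' hZ),
      mvfderiv_fun_add (mdifferentiableAt_inner g hX hY) (mdifferentiableAt_inner g hX' hY)]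
    ring

theorem koszul_tensorial_right (g : Metric E M) {Y : VField E M} {x : M} (hY : DiffAt Y x)
    (X : VField E M) (hX : DiffAt X x) :
    TensorialAt 𝓘(ℝ, E) E (fun Z : VField E M ↦ koszul g X Y Z x) x where
  smul {f Z} hf hZ := by
    simp [koszul, mlieBracket_smul_right hf hZ,
      mvfderiv_fun_mul hf (mdifferentiableAt_inner g hX hZ),
      mvfderiv_fun_mul hf (mdifferentiableAt_inner g hY hZ),
      g.symm x (Z x) (X x), g.symm x (Z x) (Y x)]
    ring
  add {Z Z'} hZ hZ' := by
    simp [koszul, mlieBracket_add_right hZ hZ',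
      mvfderiv_fun_add (mdifferentiableAt_inner g hX hZ) (mdifferentiableAt_inner g hX hZ'),
      mvfderiv_fun_add (mdifferentiableAt_inner g hY hZ) (mdifferentiableAt_inner g hY hZ')]
    ring

/-- `2 g(∇_X Y, Z)` as a bilinear form in the values of `X` and `Z` at `x`. -/
def koszulForm (g : Metric E M) (Y : VField E M) (x : M) (hY : DiffAt Y x) :
    TangentSpace 𝓘(ℝ, E) x →L[ℝ] TangentSpace 𝓘(ℝ, E) x →L[ℝ] ℝ :=
  TensorialAt.mkHom₂ (fun X Z : VField E M ↦ koszul g X Y Z x) x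
    (fun Z hZ ↦ koszul_tensorial_left g hY Z hZ) (fun X hX ↦ koszul_tensorial_right g hY X hX)

theorem koszulForm_apply (g : Metric E M) {X Y Z : VField E M} {x : M} (hX : DiffAt X x)
    (hY : DiffAt Y x) (hZ : DiffAt Z x) :
    koszulForm g Y x hY (X x) (Z x) = koszul g X Y Z x :=
  TensorialAt.mkHom₂_apply _ _ hX hZ

open Classical in
/-- The covariant derivative `v ↦ ∇_v Y` at `x` determined by the Koszul formula. -/
def koszulNabla (g : Metric E M) (Y : VField E M) (x : M) :
    TangentSpace 𝓘(ℝ, E) x →L[ℝ] TangentSpace 𝓘(ℝ, E) x :=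
  if hY : DiffAt Y x then
    haveI : FiniteDimensional ℝ (TangentSpace 𝓘(ℝ, E) x) := inferInstanceAs (FiniteDimensional ℝ E)
    haveI : T2Space (TangentSpace 𝓘(ℝ, E) x) := inferInstanceAs (T2Space E)
    LinearMap.toContinuousLinearMap
      (sharp g x ∘ₗ ((1 / 2 : ℝ) • (koszulForm g Y x hY).toLinearMap))
  else 0

theorem inner_koszulNabla (g : Metric E M) {X Y Z : VField E M} {x : M} (hX : DiffAt X x)
    (hY : DiffAt Y x) (hZ : DiffAt Z x) :
    g.inner x (koszulNabla g Y x (X x)) (Z x) = 1 / 2 * koszul g X Y Z x := by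
  simp [koszulNabla, hY, inner_sharp, koszulForm_apply g hX hY hZ]

theorem inner_ext (g : Metric E M) (x : M) {u v : TangentSpace 𝓘(ℝ, E) x}
    (h : ∀ w, g.inner x u w = g.inner x v w) : u = v := by
  by_contra hne
  have h1 := g.pos x (u - v) (sub_ne_zero.2 hne)
  simp [h] at h1

set_option linter.unusedSectionVars false in
theorem diffAt_extend {x : M} (v : TangentSpace 𝓘(ℝ, E) x) :
    DiffAt (extend E v) x :=
  mdifferentiableAt_extend (I := 𝓘(ℝ, E)) (F := E) v

/-- The Levi-Civita connection of `g`. The value `leviCivita g Y x v` is `∇_v Y` at `x`. -/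
def leviCivita (g : Metric E M) :
    CovariantDerivative 𝓘(ℝ, E) E (TangentSpace 𝓘(ℝ, E) : M → Type _) where
  toFun := koszulNabla g
  isCovariantDerivativeOnUniv :=
    { add := by
        intro Y Y' x hY hY' _
        ext v
        refine inner_ext g x fun w ↦ ?_
        have hv := diffAt_extend v
        have hw := diffAt_extend w
        have h1 := inner_koszulNabla g hv hY hw
        have h2 := inner_koszulNabla g hv hY' hw
        have h3 := inner_koszulNabla g hv (mdifferentiableAt_add_section hY hY') hw
        simp only [extend_apply_self] at h1 h2 h3
        simp only [add_apply, map_add, h1, h2, h3]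
        simp [koszul, mlieBracket_add_left hY hY', mlieBracket_add_right hY hY',
          mvfderiv_fun_add (mdifferentiableAt_inner g hv hY) (mdifferentiableAt_inner g hv hY'),
          mvfderiv_fun_add (mdifferentiableAt_inner g hY hw) (mdifferentiableAt_inner g hY' hw)]
        ring
      leibniz := by
        intro Y f x hY hf _
        ext v
        refine inner_ext g x fun w ↦ ?_
        have hv := diffAt_extend v
        have hw := diffAt_extend w
        have h1 := inner_koszulNabla g hv hY hw
        have h3 := inner_koszulNabla g hv (hf.smul_section hY) hw
        simp only [extend_apply_self] at h1 h3
        change g.inner x (koszulNabla g (f • Y) x v) w = _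
        rw [h3]
        simp [h1, koszul, mlieBracket_smul_left hf hY, mlieBracket_smul_right hf hY,
          mvfderiv_fun_mul hf (mdifferentiableAt_inner g hv hY),
          mvfderiv_fun_mul hf (mdifferentiableAt_inner g hY hw), g.symm x v (Y x)]
        ring }

/-- `D` is the Levi-Civita connection of `g`: it is torsion-free and compatible with `g`. -/
structure IsLeviCivita (g : Metric E M)
    (D : CovariantDerivative 𝓘(ℝ, E) E (TangentSpace 𝓘(ℝ, E) : M → Type _)) : Prop where
  torsion_free : ∀ (X Y : VField E M) (x : M), DiffAt X x → DiffAt Y x →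
    D Y x (X x) - D X x (Y x) = mlieBracket 𝓘(ℝ, E) X Y x
  metric : ∀ (Y Z : VField E M) (x : M), DiffAt Y x → DiffAt Z x →
    ∀ v : TangentSpace 𝓘(ℝ, E) x,
      d% (fun y ↦ g.inner y (Y y) (Z y)) x v =
        g.inner x (D Y x v) (Z x) + g.inner x (Y x) (D Z x v)

theorem isLeviCivita_leviCivita (g : Metric E M) : IsLeviCivita g (leviCivita g) where
  torsion_free X Y x hX hY := by
    refine inner_ext g x fun w ↦ ?_
    have hw := diffAt_extend w
    have h1 := inner_koszulNabla g hX hY hw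
    have h2 := inner_koszulNabla g hY hX hw
    simp only [extend_apply_self] at h1 h2
    change g.inner x (koszulNabla g Y x (X x) - koszulNabla g X x (Y x)) w = _
    simp [h1, h2, koszul, mlieBracket_swap_apply (V := Y) (W := X), g.symm _ (Y _) (X _)]
    ring
  metric Y Z x hY hZ v := by
    have hv := diffAt_extend v
    have h1 := inner_koszulNabla g hv hY hZ
    have h2 := inner_koszulNabla g hv hZ hY
    simp only [extend_apply_self] at h1 h2
    change _ = g.inner x (koszulNabla g Y x v) (Z x) + g.inner x (Y x) (koszulNabla g Z x v)
    rw [g.symm x (Y x)]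
    simp [h1, h2, koszul, mlieBracket_swap_apply (V := Z) (W := Y), g.symm _ (Z _) (Y _)]
    ring

/-- The curvature `R(X, Y)Z = ∇_X ∇_Y Z - ∇_Y ∇_X Z - ∇_[X,Y] Z` of `g`, at `x`. -/
def curv (g : Metric E M) (X Y Z : VField E M) (x : M) : TangentSpace 𝓘(ℝ, E) x :=
  leviCivita g (fun y ↦ leviCivita g Z y (Y y)) x (X x)
    - leviCivita g (fun y ↦ leviCivita g Z y (X y)) x (Y x)
    - leviCivita g Z x (mlieBracket 𝓘(ℝ, E) X Y x)

/-- The trace `∑ i, T(e_i, e_i)` of a `(0,2)`-tensor with respect to `g`. -/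
def traceAt (g : Metric E M) (x : M)
    (T : TangentSpace 𝓘(ℝ, E) x → TangentSpace 𝓘(ℝ, E) x → ℝ) : ℝ :=
  ∑ i, T (frame g x i) (frame g x i)

/-- The squared Hilbert-Schmidt norm `∑ i j, T(e_i, e_j)²` of a `(0,2)`-tensor with respect
to `g`. -/
def normSqAt (g : Metric E M) (x : M)
    (T : TangentSpace 𝓘(ℝ, E) x → TangentSpace 𝓘(ℝ, E) x → ℝ) : ℝ :=
  ∑ i, ∑ j, T (frame g x i) (frame g x j) ^ 2

/-- The Ricci tensor `Ric(v, w) = ∑ i, g(R(e_i, v)w, e_i)`. The curvature is evaluated at tangent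
vectors through vector fields extending them which are smooth near `x`. -/
def ric (g : Metric E M) (x : M) (v w : TangentSpace 𝓘(ℝ, E) x) : ℝ :=
  traceAt g x fun u u' ↦ g.inner x (curv g (extend E u) (extend E v) (extend E w) x) u'

/-- The scalar curvature. -/
def scal (g : Metric E M) (x : M) : ℝ := traceAt g x (ric g x)

/-- The gradient of `f`. -/
def grad (g : Metric E M) (f : M → ℝ) : VField E M :=
  fun x ↦ sharp g x (d% f x)

/-- The Hessian `Hess f (v, w) = g(∇_v grad f, w)`. -/
def hess (g : Metric E M) (f : M → ℝ) (x : M) (v w : TangentSpace 𝓘(ℝ, E) x) : ℝ :=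
  g.inner x (leviCivita g (grad g f) x v) w

/-- The Laplacian `Δ f = div (grad f)`, i.e. the trace of the Hessian. -/
def laplacian (g : Metric E M) (f : M → ℝ) (x : M) : ℝ := traceAt g x (hess g f x)

/-- The derivative `X(f)` of a function along a vector field. -/
def dirDeriv (X : VField E M) (f : M → ℝ) : M → ℝ := fun x ↦ d% f x (X x)

/-- The Lie derivative `(L_V g)(X, Y) = V(g(X, Y)) - g([V, X], Y) - g(X, [V, Y])`. -/
def lieMetric (g : Metric E M) (V X Y : VField E M) (x : M) : ℝ :=
  dirDeriv V (fun y ↦ g.inner y (X y) (Y y)) x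
    - g.inner x (mlieBracket 𝓘(ℝ, E) V X x) (Y x)
    - g.inner x (X x) (mlieBracket 𝓘(ℝ, E) V Y x)

/-- `(V, lam)` defines an almost Ricci soliton on `(M, g)`: `V` is a smooth vector field, `lam` is a
smooth function, and `1/2 L_V g + Ric = lam g`. -/
structure IsAlmostRicciSoliton (g : Metric E M) (V : VField E M) (lam : M → ℝ) : Prop where
  smooth_field : IsSmooth V
  smooth_lam : ContMDiff 𝓘(ℝ, E) 𝓘(ℝ, ℝ) ∞ lam
  equation : ∀ X Y : VField E M, IsSmooth X → IsSmooth Y → ∀ x : M,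
    1 / 2 * lieMetric g V X Y x + ric g x (X x) (Y x) = lam x * g.inner x (X x) (Y x)

end Riemannian

section Contact

/-- Almost contact metric structures `(φ, ξ, η, g)` on `M`. -/
structure AlmostContactMetric (E : Type*) [NormedAddCommGroup E] [NormedSpace ℝ E]
    [FiniteDimensional ℝ E] (M : Type*) [TopologicalSpace M] [ChartedSpace E M]
    [IsManifold 𝓘(ℝ, E) ∞ M] where
  /-- the `(1,1)`-tensor field -/
  φ : Π x : M, TangentSpace 𝓘(ℝ, E) x →L[ℝ] TangentSpace 𝓘(ℝ, E) x
  /-- the Reeb vector field -/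
  ξ : VField E M
  /-- the `1`-form -/
  η : Π x : M, TangentSpace 𝓘(ℝ, E) x →L[ℝ] ℝ
  /-- the Riemannian metric -/
  g : Metric E M
  smooth_φ : ContMDiff 𝓘(ℝ, E) (𝓘(ℝ, E).prod 𝓘(ℝ, E →L[ℝ] E)) ∞
    (fun x ↦ TotalSpace.mk' (E →L[ℝ] E)
      (E := fun x : M ↦ TangentSpace 𝓘(ℝ, E) x →L[ℝ] TangentSpace 𝓘(ℝ, E) x) x (φ x))
  smooth_ξ : IsSmooth ξ
  smooth_η : ContMDiff 𝓘(ℝ, E) (𝓘(ℝ, E).prod 𝓘(ℝ, E →L[ℝ] ℝ)) ∞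
    (fun x ↦ TotalSpace.mk' (E →L[ℝ] ℝ)
      (E := fun x : M ↦ TangentSpace 𝓘(ℝ, E) x →L[ℝ] Bundle.Trivial M ℝ x) x (η x))
  φ_sq : ∀ x v, φ x (φ x v) = -v + η x v • ξ x
  η_ξ : ∀ x, η x (ξ x) = 1
  η_eq : ∀ x v, η x v = g.inner x (ξ x) v
  inner_φ : ∀ x v w, g.inner x (φ x v) (φ x w) = g.inner x v w - η x v * η x w

variable {E : Type*} [NormedAddCommGroup E] [NormedSpace ℝ E] [FiniteDimensional ℝ E]
  {M : Type*} [TopologicalSpace M] [ChartedSpace E M] [IsManifold 𝓘(ℝ, E) ∞ M]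

namespace AlmostContactMetric

/-- The structure is Kenmotsu: `(∇_X φ)Y = g(φ X, Y) ξ - η(Y) φ X` for the Levi-Civita connection
of `g`, where `(∇_X φ)Y = ∇_X (φ Y) - φ (∇_X Y)`. -/
def IsKenmotsu (S : AlmostContactMetric E M) : Prop :=
  ∀ X Y : VField E M, IsSmooth X → IsSmooth Y → ∀ x : M,
    leviCivita S.g (fun y ↦ S.φ y (Y y)) x (X x) - S.φ x (leviCivita S.g Y x (X x)) =
      S.g.inner x (S.φ x (X x)) (Y x) • S.ξ x - S.η x (Y x) • S.φ x (X x)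

theorem sq_η_le (S : AlmostContactMetric E M) (x : M) (v : TangentSpace 𝓘(ℝ, E) x) :
    S.η x v ^ 2 ≤ S.g.inner x v v := by
  have h := S.inner_φ x v v
  have h2 : 0 ≤ S.g.inner x (S.φ x v) (S.φ x v) := by
    rcases eq_or_ne (S.φ x v) 0 with h0 | h0
    · simp [h0]
    · exact (S.g.pos x _ h0).le
  nlinarith

theorem η_φ (S : AlmostContactMetric E M) (x : M) (v : TangentSpace 𝓘(ℝ, E) x) :
    S.η x (S.φ x v) = 0 := by
  have h1 : S.φ x (S.ξ x) = 0 := by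
    by_contra h
    have h2 := S.g.pos x _ h
    rw [S.inner_φ, ← S.η_eq, S.η_ξ] at h2
    norm_num at h2
  have h3 := S.φ_sq x (S.φ x v)
  rw [S.φ_sq x v, map_add, map_neg, map_smul, h1, smul_zero, add_right_inj] at h3
  have h4 := congrArg (S.η x) h3.symm
  rwa [map_smul, S.η_ξ, smul_eq_mul, mul_one, map_zero] at h4

theorem smooth_η_tensor_η (S : AlmostContactMetric E M) :
    ContMDiff 𝓘(ℝ, E) (𝓘(ℝ, E).prod 𝓘(ℝ, E →L[ℝ] E →L[ℝ] ℝ)) ∞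
      (fun x ↦ TotalSpace.mk' (E →L[ℝ] E →L[ℝ] ℝ)
        (E := fun x : M ↦ TangentSpace 𝓘(ℝ, E) x →L[ℝ] TangentSpace 𝓘(ℝ, E) x →L[ℝ]
          Bundle.Trivial M ℝ x) x ((S.η x).smulRight (S.η x))) := by
  intro x₀
  have h := (contMDiffAt_hom_bundle _).1 (S.smooth_η x₀)
  refine (contMDiffAt_hom_bundle _).2 ⟨contMDiffAt_id, ?_⟩
  have h2 := (contDiff_smulRight_self E).comp_contMDiffAt h.2
  refine h2.congr_of_eventuallyEq ?_
  have A : ∀ᶠ y in 𝓝 x₀, y ∈ (trivializationAt E (TangentSpace 𝓘(ℝ, E)) x₀).baseSet :=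
    (trivializationAt E (TangentSpace 𝓘(ℝ, E)) x₀).open_baseSet.mem_nhds
      (FiberBundle.mem_baseSet_trivializationAt' x₀)
  filter_upwards [A] with y hy
  ext v w
  rw [inCoordinates_apply_eq₂ hy hy (by simp)]
  simp [ContinuousLinearMap.inCoordinates]
  rw [Trivialization.symmL_apply _ hy, Trivialization.symmL_apply _ hy]

/-- The metric `a g + a (a - 1) η ⊗ η`. -/
def deformMetric (S : AlmostContactMetric E M) (a : ℝ) (ha : 0 < a) : Metric E M where
  inner x := a • S.g.inner x + (a * (a - 1)) • (S.η x).smulRight (S.η x)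
  symm x v w := by
    simp only [add_apply, smul_apply, ContinuousLinearMap.smulRight_apply, smul_eq_mul,
      S.g.symm x v w]
    ring
  pos x v hv := by
    have h1 := S.g.pos x v hv
    have h2 := S.sq_η_le x v
    simp only [add_apply, smul_apply, ContinuousLinearMap.smulRight_apply, smul_eq_mul]
    rcases lt_or_ge a 1 with h | h
    · nlinarith [mul_nonneg (mul_nonneg ha.le (sub_nonneg.2 h.le)) (sub_nonneg.2 h2),
        mul_pos (mul_pos ha ha) h1]
    · nlinarith [mul_nonneg (mul_nonneg ha.le (sub_nonneg.2 h)) (sq_nonneg (S.η x v)),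
        mul_pos ha h1]
  isVonNBounded x := by
    have hr : 0 < 1 + 1 / a := by positivity
    refine (Bornology.IsVonNBounded.image (S.g.isVonNBounded x)
      ((1 + 1 / a) • ContinuousLinearMap.id ℝ (TangentSpace 𝓘(ℝ, E) x))).subset fun v hv ↦ ?_
    refine ⟨(1 + 1 / a)⁻¹ • v, ?_, smul_inv_smul₀ hr.ne' v⟩
    have h1 := S.sq_η_le x v
    have h2 : 0 ≤ S.g.inner x v v := (sq_nonneg _).trans h1
    simp only [mem_ofPred_eq, add_apply, smul_apply, ContinuousLinearMap.smulRight_apply,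
      smul_eq_mul, map_smul] at hv ⊢
    have h3 : (1 + 1 / a)⁻¹ = a / (a + 1) := by field_simp
    rw [h3]
    have h4 : a / (a + 1) * (a / (a + 1) * S.g.inner x v v) =
      a ^ 2 * S.g.inner x v v / (a + 1) ^ 2 := by field_simp
    rw [h4, div_lt_one (by positivity)]
    nlinarith [mul_nonneg ha.le h2, mul_nonneg ha.le (sub_nonneg.2 h1),
      mul_nonneg (sq_nonneg a) (sq_nonneg (S.η x v)), mul_nonneg ha.le (sq_nonneg (S.η x v)),
      mul_nonneg (sq_nonneg a) (sub_nonneg.2 h1), mul_nonneg (pow_nonneg ha.le 3) (sub_nonneg.2 h1)]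
  contMDiff := by
    have h := (S.g.contMDiff.const_smul_section (a := a)).add_section
      (S.smooth_η_tensor_η.const_smul_section (a := a * (a - 1)))
    exact h

/-- The `D`-homothetic deformation `(φ, a⁻¹ ξ, a η, a g + a (a - 1) η ⊗ η)`. -/
def deform (S : AlmostContactMetric E M) (a : ℝ) (ha : 0 < a) : AlmostContactMetric E M where
  φ := S.φ
  ξ := fun x ↦ (1 / a) • S.ξ x
  η := fun x ↦ a • S.η x
  g := S.deformMetric a ha
  smooth_φ := S.smooth_φ
  smooth_ξ := S.smooth_ξ.const_smul_section
  smooth_η := S.smooth_η.const_smul_section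
  φ_sq x v := by
    rw [S.φ_sq, smul_apply, smul_smul, smul_eq_mul]
    congr 2
    field_simp
  η_ξ x := by simp [S.η_ξ, ha.ne']
  η_eq x v := by
    simp [deformMetric, S.η_ξ, ← S.η_eq]
    field_simp
    ring
  inner_φ x v w := by
    simp [deformMetric, S.inner_φ, S.η_φ]
    ring

end AlmostContactMetric

end Contact

end Kenmotsu

end

open Kenmotsu

/-! Write `T = g - η ⊗ η`, `c = (a - 1) / a` and `m = 2n + 1`. The Kenmotsu condition forces `∇_v ξ
= v - η(v) ξ`, equivalently `∇η = T`. Since `∇η` is symmetric, the Koszul formula for the deformed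
metric changes the connection only along `ξ`: `∇̄_v Y = ∇_v Y + c T(v, Y) ξ` (`deform_nabla`).
Differentiating once more adds `c (T(Y, Z) X - T(X, Z) Y)` to the curvature (`deform_curv`); a trace
then adds `2n c T` to Ricci (`deform_ric`), while the Hessian of `f` loses `c ξ(f) T`
(`deform_hess`). Because `L_V ḡ` is twice the deformed Hessian, the soliton equation becomes `Ric =
-Hess f + u g + b η ⊗ η` with explicit functions `u`, `b` (`ric_of_soliton`). On `(ξ, ξ)`, the
identity `Ric(ξ, ξ) = -2n` (`ric_ξ`) determines `λ̄` from `ξ(ξ(f))`. Expanding `|Ric|²` and `scal`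
in an orthonormal frame then shows that the two sides of the inequality differ by exactly a square
divided by `m`. -/

namespace Kenmotsu

/-! ### Derivatives of brackets, functions and covariant derivatives of `C²` fields. -/

section Calculus

variable {E : Type*} [NormedAddCommGroup E] [NormedSpace ℝ E] [FiniteDimensional ℝ E]
  {M : Type*} [TopologicalSpace M] [ChartedSpace E M] [IsManifold 𝓘(ℝ, E) ∞ M]

/-- The vector field `X` is twice continuously differentiable at `x`. -/
abbrev C2At (X : VField E M) (x : M) : Prop :=
  ContMDiffAt 𝓘(ℝ, E) 𝓘(ℝ, E).tangent 2 (fun x ↦ (X x : TangentBundle 𝓘(ℝ, E) M)) x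

theorem two_le_infty : (2 : ℕ∞ω) ≤ ∞ :=
  WithTop.coe_le_coe.2 (le_top : (2 : ℕ∞) ≤ ⊤)

set_option linter.unusedSectionVars false in
theorem isManifold_three : IsManifold 𝓘(ℝ, E) 3 M :=
  IsManifold.of_le (n := ∞) (WithTop.coe_le_coe.2 (le_top : (3 : ℕ∞) ≤ ⊤))

set_option linter.unusedSectionVars false in
theorem isManifold_two : IsManifold 𝓘(ℝ, E) 2 M :=
  IsManifold.of_le (n := ∞) two_le_infty

set_option linter.unusedSectionVars false in
theorem C2At.diffAt {X : VField E M} {x : M} (hX : C2At X x) : DiffAt X x :=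
  hX.mdifferentiableAt two_ne_zero

set_option linter.unusedSectionVars false in
theorem IsSmooth.c2At {X : VField E M} (hX : IsSmooth X) (x : M) : C2At X x :=
  (hX x).of_le two_le_infty

theorem c2At_extend {x : M} (v : TangentSpace 𝓘(ℝ, E) x) : C2At (extend E v) x := by
  have := isManifold_three (E := E) (M := M)
  exact contMDiffAt_extend (k := 2) 𝓘(ℝ, E) E v

theorem contMDiffAt_two_eventually {h : M → ℝ} {x : M} (hh : ContMDiffAt 𝓘(ℝ, E) 𝓘(ℝ, ℝ) 2 h x) :
    ∀ᶠ y in 𝓝 x, ContMDiffAt 𝓘(ℝ, E) 𝓘(ℝ, ℝ) 2 h y := by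
  have := isManifold_two (E := E) (M := M)
  exact (contMDiffAt_iff_contMDiffAt_nhds (by exact_mod_cast (by decide))).1 hh

theorem C2At.eventually {X : VField E M} {x : M} (hX : C2At X x) : ∀ᶠ y in 𝓝 x, C2At X y := by
  have := isManifold_three (E := E) (M := M)
  have := isManifold_two (E := E) (M := M)
  have : IsManifold (𝓘(ℝ, E).tangent) 2 (TangentBundle 𝓘(ℝ, E) M) := inferInstance
  exact (contMDiffAt_iff_contMDiffAt_nhds (by exact_mod_cast (by decide))).1 hX

theorem contMDiffAt_inner (g : Metric E M) {X Y : VField E M} {x : M}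
    (hX : C2At X x) (hY : C2At Y x) :
    ContMDiffAt 𝓘(ℝ, E) 𝓘(ℝ, ℝ) 2 (fun y ↦ g.inner y (X y) (Y y)) x := by
  let _ : RiemannianBundle (fun x : M ↦ TangentSpace 𝓘(ℝ, E) x) := ⟨g.toRiemannianMetric⟩
  have : IsContMDiffRiemannianBundle 𝓘(ℝ, E) 2 E (fun x : M ↦ TangentSpace 𝓘(ℝ, E) x) :=
    ⟨⟨g.inner, g.contMDiff.of_le two_le_infty, fun _ _ _ ↦ rfl⟩⟩
  have := isManifold_three (E := E) (M := M)
  exact ContMDiffAt.inner_bundle (F := E) (E := fun x : M ↦ TangentSpace 𝓘(ℝ, E) x) hX hY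

theorem diffAt_mlieBracket {X Y : VField E M} {x : M} (hX : C2At X x) (hY : C2At Y x) :
    DiffAt (mlieBracket 𝓘(ℝ, E) X Y) x := by
  have := isManifold_three (E := E) (M := M)
  have : IsManifold 𝓘(ℝ, E) (((2 : ℕ∞) : ℕ∞ω) + 1) M := by
    convert this using 1
    norm_num
  have : IsManifold 𝓘(ℝ, E) (minSmoothness ℝ 2) M := by
    simpa using isManifold_two (E := E) (M := M)
  have h : ContMDiffAt 𝓘(ℝ, E) 𝓘(ℝ, E).tangent ((1 : ℕ∞) : ℕ∞ω)
      (fun y ↦ (mlieBracket 𝓘(ℝ, E) X Y y : TangentBundle 𝓘(ℝ, E) M)) x :=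
    ContMDiffAt.mlieBracket_vectorField (m := 1) (n := 2) hX hY (by simp; norm_num)
  exact h.mdifferentiableAt (by simp)

theorem mdifferentiableAt_dirDeriv {X : VField E M} {h : M → ℝ} {x : M} (hX : C2At X x)
    (hh : ContMDiffAt 𝓘(ℝ, E) 𝓘(ℝ, ℝ) 2 h x) :
    MDifferentiableAt 𝓘(ℝ, E) 𝓘(ℝ, ℝ) (dirDeriv X h) x := by
  have := isManifold_two (E := E) (M := M)
  have h1 := hh.mfderiv_const (m := 1) (by norm_num)
  have h2 := ContMDiffAt.clm_apply_of_inCoordinates (n := 1) (b₁ := id) (b₂ := h) (v := X)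
    (E₁ := fun x : M ↦ TangentSpace 𝓘(ℝ, E) x) (F₁ := E) (F₂ := ℝ)
    (E₂ := fun x : ℝ ↦ TangentSpace 𝓘(ℝ, ℝ) x) (ϕ := fun m ↦ mfderiv 𝓘(ℝ, E) 𝓘(ℝ, ℝ) h m)
    (m₀ := x) h1 (hX.of_le (by norm_num)) (hh.of_le (by norm_num))
  have h3 := (contMDiffAt_totalSpace.1 h2).2
  have h4 := h3.mdifferentiableAt one_ne_zero
  convert! h4 using 1
  ext y
  simp [dirDeriv, mvfderiv]
  rfl

/-- This is the second-order Leibniz rule. Second derivatives of `h` occur only in the coefficient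
of `Z`, so the Jacobi identity for `h • Z` isolates the commutator of `X` and `Y` acting on `h`. -/
theorem mlieBracket_mlieBracket_smul {X Y Z : VField E M} {h : M → ℝ} {x : M}
    (hY : C2At Y x) (hZ : C2At Z x) (hh : ContMDiffAt 𝓘(ℝ, E) 𝓘(ℝ, ℝ) 2 h x) :
    mlieBracket 𝓘(ℝ, E) X (mlieBracket 𝓘(ℝ, E) Y (h • Z)) x =
      dirDeriv X (dirDeriv Y h) x • Z x + dirDeriv Y h x • mlieBracket 𝓘(ℝ, E) X Z x
        + dirDeriv X h x • mlieBracket 𝓘(ℝ, E) Y Z x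
        + h x • mlieBracket 𝓘(ℝ, E) X (mlieBracket 𝓘(ℝ, E) Y Z) x := by
  have e : mlieBracket 𝓘(ℝ, E) Y (h • Z) =ᶠ[𝓝 x]
      dirDeriv Y h • Z + h • mlieBracket 𝓘(ℝ, E) Y Z := by
    filter_upwards [hZ.eventually, contMDiffAt_two_eventually hh] with y hZy hhy
    exact mlieBracket_smul_right (hhy.mdifferentiableAt two_ne_zero) hZy.diffAt
  have h1 := mdifferentiableAt_dirDeriv hY hh
  have h2 := hh.mdifferentiableAt two_ne_zero
  have h3 := diffAt_mlieBracket hY hZ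
  rw [Filter.EventuallyEq.mlieBracket_vectorField_eq (.refl _ X) e,
    mlieBracket_add_right (h1.smul_section hZ.diffAt) (h2.smul_section h3),
    mlieBracket_smul_right h1 hZ.diffAt, mlieBracket_smul_right h2 h3]
  simp only [dirDeriv]
  abel

/-- Derivations along vector fields satisfy `X (Y h) - Y (X h) = [X, Y] h`. -/
theorem dirDeriv_comm {X Y : VField E M} {h : M → ℝ} {x : M} (hX : C2At X x)
    (hY : C2At Y x) (hh : ContMDiffAt 𝓘(ℝ, E) 𝓘(ℝ, ℝ) 2 h x) :
    dirDeriv X (dirDeriv Y h) x - dirDeriv Y (dirDeriv X h) x =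
      d% h x (mlieBracket 𝓘(ℝ, E) X Y x) := by
  have := isManifold_three (E := E) (M := M)
  have : IsManifold 𝓘(ℝ, E) (minSmoothness ℝ 3) M := by simpa using this
  -- The Jacobi identity for `X, Y, hZ`, minus `h` times the one for `X, Y, Z`, leaves this scalar
  -- times `Z x = v`.
  have key : ∀ v : TangentSpace 𝓘(ℝ, E) x, (dirDeriv X (dirDeriv Y h) x
      - dirDeriv Y (dirDeriv X h) x - d% h x (mlieBracket 𝓘(ℝ, E) X Y x)) • v = 0 := by
    intro v
    have hZ := c2At_extend v
    have hhZ : C2At (h • extend E v) x := ContMDiffAt.smul_section hh hZ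
    have j1 := leibniz_identity_mlieBracket_apply (I := 𝓘(ℝ, E)) (U := X) (V := Y)
      (W := extend E v) (x := x) (by simpa using hX) (by simpa using hY) (by simpa using hZ)
    have j2 := leibniz_identity_mlieBracket_apply (I := 𝓘(ℝ, E)) (U := X) (V := Y)
      (W := h • extend E v) (x := x) (by simpa using hX) (by simpa using hY)
      (by rw [minSmoothness_of_isRCLikeNormedField]; exact hhZ)
    rw [mlieBracket_mlieBracket_smul hY hZ hh, mlieBracket_mlieBracket_smul hX hZ hh,
      mlieBracket_smul_right (hh.mdifferentiableAt two_ne_zero) hZ.diffAt, j1,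
      extend_apply_self] at j2
    rw [← sub_eq_zero] at j2
    rw [← j2]
    module
  by_contra hne
  -- A nonzero scalar would make the tangent space trivial, and then every term of the identity
  -- vanishes anyway.
  have h0 : ∀ v : TangentSpace 𝓘(ℝ, E) x, v = 0 := fun v ↦
    (smul_eq_zero.1 (key v)).resolve_left (sub_ne_zero.2 hne)
  apply hne
  rw [h0 (mlieBracket 𝓘(ℝ, E) X Y x), dirDeriv, dirDeriv, h0 (X x), h0 (Y x)]
  simp

/-- A vector field whose products with all `C²` fields are differentiable is differentiable. -/
theorem diffAt_of_inner (g : Metric E M) {W : VField E M} {x : M}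
    (h : ∀ Z : VField E M, C2At Z x →
      MDifferentiableAt 𝓘(ℝ, E) 𝓘(ℝ, ℝ) (fun y ↦ g.inner y (W y) (Z y)) x) : DiffAt W x := by
  have := isManifold_three (E := E) (M := M)
  let t := trivializationAt E (TangentSpace 𝓘(ℝ, E) : M → Type _) x
  have hx : x ∈ t.baseSet := FiberBundle.mem_baseSet_trivializationAt' x
  let b := Module.finBasis ℝ E
  let s := t.localFrame b
  let c := fun i ↦ (t.localFrameCoeff 𝓘(ℝ, E) b i)
  have hs : ∀ i, C2At (s i) x := fun i ↦ contMDiffAt_localFrame_of_mem 2 t b i hx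
  -- The Gram matrix of the local frame: it sends the frame coefficients of `W` to the products of
  -- `W` with the frame. Positivity of `g` makes it injective, hence invertible.
  let A : M → (Fin (finrank ℝ E) → ℝ) →L[ℝ] (Fin (finrank ℝ E) → ℝ) := fun y ↦
    ∑ i, ∑ j, g.inner y (s i y) (s j y) •
      (ContinuousLinearMap.proj i).smulRight (Pi.single j (1 : ℝ))
  let C : M → Fin (finrank ℝ E) → ℝ := fun y i ↦ c i y (W y)
  have hAapp : ∀ y (u : Fin (finrank ℝ E) → ℝ) j,
      A y u j = g.inner y (∑ i, u i • s i y) (s j y) := by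
    intro y u j
    simp [A, Pi.single_apply, mul_comm]
  have hAC : ∀ y ∈ t.baseSet, A y (C y) = fun j ↦ g.inner y (W y) (s j y) := by
    intro y hy
    ext j
    rw [hAapp, ← t.eq_sum_localFrameCoeff_smul (I := 𝓘(ℝ, E)) (b := b) (s := W) hy]
  have hinj : ∀ y ∈ t.baseSet, Function.Injective (A y) := by
    intro y hy
    refine (injective_iff_map_eq_zero _).2 fun u hu ↦ ?_
    have h1 : g.inner y (∑ i, u i • s i y) (∑ i, u i • s i y) = 0 := by
      conv_lhs => rw [map_sum]
      refine Finset.sum_eq_zero fun j _ ↦ ?_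
      rw [map_smul, ← hAapp, hu]
      simp
    have h2 : ∑ i, u i • s i y = 0 := by
      by_contra h0
      exact (g.pos y _ h0).ne' h1
    have h3 := (t.isLocalFrameOn_localFrame_baseSet 𝓘(ℝ, E) 2 b).linearIndependent hy
    ext i
    exact Fintype.linearIndependent_iff.1 h3 u h2 i
  have hAd : MDifferentiableAt 𝓘(ℝ, E) 𝓘(ℝ, (Fin (finrank ℝ E) → ℝ) →L[ℝ] (Fin (finrank ℝ E) → ℝ))
      A x := by
    have h1 : MDifferentiableAt 𝓘(ℝ, E)
        𝓘(ℝ, (Fin (finrank ℝ E) → ℝ) →L[ℝ] (Fin (finrank ℝ E) → ℝ))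
        (∑ i, ∑ j, fun y ↦ g.inner y (s i y) (s j y) •
          (ContinuousLinearMap.proj (R := ℝ) (φ := fun _ : Fin (finrank ℝ E) ↦ ℝ) i).smulRight
            (Pi.single (M := fun _ : Fin (finrank ℝ E) ↦ ℝ) j (1 : ℝ))) x :=
      MDifferentiableAt.sum fun i _ ↦ MDifferentiableAt.sum fun j _ ↦
        (mdifferentiableAt_inner g (hs i).diffAt (hs j).diffAt).smul mdifferentiableAt_const
    convert! h1 using 1
    ext1 y
    simp [A]
  have hβ : MDifferentiableAt 𝓘(ℝ, E) 𝓘(ℝ, Fin (finrank ℝ E) → ℝ)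
      (fun y j ↦ g.inner y (W y) (s j y)) x := by
    have h1 : MDifferentiableAt 𝓘(ℝ, E) 𝓘(ℝ, Fin (finrank ℝ E) → ℝ)
        (∑ j, fun y ↦ g.inner y (W y) (s j y) •
          (Pi.single (M := fun _ : Fin (finrank ℝ E) ↦ ℝ) j (1 : ℝ))) x :=
      MDifferentiableAt.sum fun j _ ↦ (h _ (hs j)).smul mdifferentiableAt_const
    convert! h1 using 1
    ext y i
    simp [Pi.single_apply]
  have hC : MDifferentiableAt 𝓘(ℝ, E) 𝓘(ℝ, Fin (finrank ℝ E) → ℝ) C x := by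
    let e := (LinearEquiv.ofInjectiveEndo (A x).toLinearMap (hinj x hx)).toContinuousLinearEquiv
    have he : (e : (Fin (finrank ℝ E) → ℝ) →L[ℝ] (Fin (finrank ℝ E) → ℝ)) = A x := by
      ext1; rfl
    -- Inversion is differentiable at an invertible map, so the coefficients `A⁻¹ β` of `W` are
    -- differentiable.
    have h1 := (contDiffAt_map_inverse (n := 1) (𝕜 := ℝ) e).differentiableAt one_ne_zero
    rw [he] at h1
    have h2 := (h1.mdifferentiableAt.comp x hAd).clm_apply hβ
    refine h2.congr_of_eventuallyEq ?_
    filter_upwards [t.open_baseSet.mem_nhds hx] with y hy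
    let e' := (LinearEquiv.ofInjectiveEndo (A y).toLinearMap (hinj y hy)).toContinuousLinearEquiv
    have he' : (e' : (Fin (finrank ℝ E) → ℝ) →L[ℝ] (Fin (finrank ℝ E) → ℝ)) = A y := by
      ext1; rfl
    rw [← hAC y hy, Function.comp_apply, ← he', ContinuousLinearMap.inverse_equiv]
    simp
  refine (mdifferentiableAt_iff_localFrameCoeff b hx).2 fun i ↦ ?_
  exact (ContinuousLinearMap.proj (R := ℝ) (φ := fun _ : Fin (finrank ℝ E) ↦ ℝ)
    i).differentiableAt.comp_mdifferentiableAt hC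

/-- The covariant derivative of `C²` fields is differentiable. -/
theorem diffAt_leviCivita (g : Metric E M) {Y Z : VField E M} {x : M} (hY : C2At Y x)
    (hZ : C2At Z x) : DiffAt (fun y ↦ leviCivita g Z y (Y y)) x := by
  refine diffAt_of_inner g fun W hW ↦ ?_
  -- Paired with a `C²` field, the covariant derivative is half the Koszul expression, whose six
  -- terms are all differentiable.
  have h1 : (fun y ↦ g.inner y (leviCivita g Z y (Y y)) (W y)) =ᶠ[𝓝 x]
      fun y ↦ 1 / 2 * koszul g Y Z W y := by
    filter_upwards [hY.eventually, hZ.eventually, hW.eventually] with y h1 h2 h3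
    exact inner_koszulNabla g h1.diffAt h2.diffAt h3.diffAt
  refine MDifferentiableAt.congr_of_eventuallyEq ?_ h1
  have a1 := mdifferentiableAt_dirDeriv hY (contMDiffAt_inner g hZ hW)
  have a2 := mdifferentiableAt_dirDeriv hZ (contMDiffAt_inner g hY hW)
  have a3 := mdifferentiableAt_dirDeriv hW (contMDiffAt_inner g hY hZ)
  have a4 := mdifferentiableAt_inner g (diffAt_mlieBracket hY hZ) hW.diffAt
  have a5 := mdifferentiableAt_inner g (diffAt_mlieBracket hY hW) hZ.diffAt
  have a6 := mdifferentiableAt_inner g (diffAt_mlieBracket hZ hW) hY.diffAt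
  exact mdifferentiableAt_const.mul (((((a1.add a2).sub a3).add a4).sub a5).sub a6)

end Calculus

/-! ### Tensoriality and skew-symmetry of the curvature; Ricci as a trace. -/

section Curvature

variable {E : Type*} [NormedAddCommGroup E] [NormedSpace ℝ E] [FiniteDimensional ℝ E]
  {M : Type*} [TopologicalSpace M] [ChartedSpace E M] [IsManifold 𝓘(ℝ, E) ∞ M]

theorem leviCivita_add (g : Metric E M) {Y Y' : VField E M} {x : M} (hY : DiffAt Y x)
    (hY' : DiffAt Y' x) (v : TangentSpace 𝓘(ℝ, E) x) :
    leviCivita g (Y + Y') x v = leviCivita g Y x v + leviCivita g Y' x v := by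
  rw [(leviCivita g).isCovariantDerivativeOnUniv.add hY hY']
  rfl

theorem leviCivita_smul (g : Metric E M) {Y : VField E M} {h : M → ℝ} {x : M} (hY : DiffAt Y x)
    (hh : MDifferentiableAt 𝓘(ℝ, E) 𝓘(ℝ, ℝ) h x) (v : TangentSpace 𝓘(ℝ, E) x) :
    leviCivita g (h • Y) x v = h x • leviCivita g Y x v + d% h x v • Y x := by
  rw [(leviCivita g).isCovariantDerivativeOnUniv.leibniz hY hh]
  rfl

theorem leviCivita_const_smul (g : Metric E M) {Y : VField E M} (c : ℝ) {x : M} (hY : DiffAt Y x)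
    (v : TangentSpace 𝓘(ℝ, E) x) :
    leviCivita g (c • Y) x v = c • leviCivita g Y x v := by
  rw [(leviCivita g).isCovariantDerivativeOnUniv.smul_const c hY]
  rfl

theorem leviCivita_congr (g : Metric E M) {Y Y' : VField E M} {x : M} (hY : DiffAt Y x)
    (h : Y =ᶠ[𝓝 x] Y') : leviCivita g Y x = leviCivita g Y' x := by
  refine (leviCivita g).isCovariantDerivativeOnUniv.congr_of_eventuallyEq hY ?_ Filter.univ_mem h
  exact hY.congr_of_eventuallyEq (h.symm.mono fun y hy ↦ by simp [hy])

set_option linter.unusedSectionVars false in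
theorem mvfderiv_congr {h h' : M → ℝ} {x : M} (hh : h =ᶠ[𝓝 x] h') : d% h x = d% h' x := by
  ext v
  simp only [mvfderiv, hh.mfderiv_eq]
  rfl

-- Near `x` the extension of `v` is constant in the trivialization at `x`, hence linear in `v`; this
-- makes curvature on extended vectors linear in its first argument.
set_option linter.unusedSectionVars false in
theorem eventually_extend_eq {x : M} : ∀ᶠ y in 𝓝 x, ∀ v : TangentSpace 𝓘(ℝ, E) x,
    extend E v y =
      (trivializationAt E (TangentSpace 𝓘(ℝ, E) : M → Type _) x).symmₗ ℝ y
        ((trivializationAt E (TangentSpace 𝓘(ℝ, E) : M → Type _) x).linearMapAt ℝ x v) := by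
  have hx := FiberBundle.mem_baseSet_trivializationAt' (F := E)
    (E := (TangentSpace 𝓘(ℝ, E) : M → Type _)) x
  filter_upwards [(trivializationAt E (TangentSpace 𝓘(ℝ, E) : M → Type _)
    x).open_baseSet.mem_nhds hx] with y hy v
  rw [Trivialization.linearMapAt_apply, if_pos hx]
  exact (Trivialization.symmₗ_apply _ hy _).symm

theorem extend_add {x : M} (u v : TangentSpace 𝓘(ℝ, E) x) :
    (extend E (u + v) : VField E M) =ᶠ[𝓝 x] extend E u + extend E v := by
  filter_upwards [eventually_extend_eq (E := E) (x := x)] with y hy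
  simp only [Pi.add_apply, hy, map_add]
  rfl

theorem extend_smul {x : M} (c : ℝ) (v : TangentSpace 𝓘(ℝ, E) x) :
    (extend E (c • v) : VField E M) =ᶠ[𝓝 x] c • extend E v := by
  filter_upwards [eventually_extend_eq (E := E) (x := x)] with y hy
  simp only [Pi.smul_apply, hy, map_smul]
  rfl

theorem curv_congr_left (g : Metric E M) {X X' Y Z : VField E M} {x : M} (hX : C2At X x)
    (hZ : C2At Z x) (h : X =ᶠ[𝓝 x] X') : curv g X Y Z x = curv g X' Y Z x := by
  have h1 : (fun y ↦ leviCivita g Z y (X y)) =ᶠ[𝓝 x] fun y ↦ leviCivita g Z y (X' y) :=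
    h.mono fun y hy ↦ congrArg (leviCivita g Z y) hy
  rw [curv, curv, leviCivita_congr g (diffAt_leviCivita g hX hZ) h1, h.self_of_nhds,
    h.mlieBracket_vectorField_eq (.refl _ Y)]

theorem curv_add_left (g : Metric E M) {X X' Y Z : VField E M} {x : M} (hX : C2At X x)
    (hX' : C2At X' x) (hZ : C2At Z x) :
    curv g (X + X') Y Z x = curv g X Y Z x + curv g X' Y Z x := by
  have h1 : (fun y ↦ leviCivita g Z y ((X + X') y)) =
      (fun y ↦ leviCivita g Z y (X y)) + fun y ↦ leviCivita g Z y (X' y) := by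
    ext1 y; simp
  rw [curv, h1, leviCivita_add g (diffAt_leviCivita g hX hZ) (diffAt_leviCivita g hX' hZ),
    mlieBracket_add_left hX.diffAt hX'.diffAt, Pi.add_apply, map_add, map_add, curv, curv]
  abel

theorem curv_smul_left (g : Metric E M) (c : ℝ) {X Y Z : VField E M} {x : M} (hX : C2At X x)
    (hZ : C2At Z x) : curv g (c • X) Y Z x = c • curv g X Y Z x := by
  have h1 : (fun y ↦ leviCivita g Z y ((c • X) y)) = c • fun y ↦ leviCivita g Z y (X y) := by
    ext1 y; simp
  rw [curv, h1, leviCivita_const_smul g c (diffAt_leviCivita g hX hZ),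
    mlieBracket_const_smul_left hX.diffAt, Pi.smul_apply, map_smul, map_smul, curv, smul_sub,
    smul_sub]

/-- The endomorphism `u ↦ R(u, v)w` of the tangent space at `x`. -/
noncomputable def curvEnd (g : Metric E M) (x : M) (v w : TangentSpace 𝓘(ℝ, E) x) :
    TangentSpace 𝓘(ℝ, E) x →ₗ[ℝ] TangentSpace 𝓘(ℝ, E) x where
  toFun u := curv g (extend E u) (extend E v) (extend E w) x
  map_add' u u' := by
    rw [curv_congr_left g (c2At_extend _) (c2At_extend w) (extend_add u u'),
      curv_add_left g (c2At_extend u) (c2At_extend u') (c2At_extend w)]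
  map_smul' c u := by
    rw [curv_congr_left g (c2At_extend _) (c2At_extend w) (extend_smul c u),
      curv_smul_left g c (c2At_extend u) (c2At_extend w), RingHom.id_apply]

theorem frame_repr (g : Metric E M) (x : M) (v : TangentSpace 𝓘(ℝ, E) x)
    (i : Fin (finrank ℝ E)) : (frame g x).repr v i = g.inner x v (frame g x i) := by
  conv_rhs => rw [← (frame g x).sum_repr v]
  simp [-Basis.sum_repr, inner_frame]

theorem sum_inner_frame_smul (g : Metric E M) (x : M) (v : TangentSpace 𝓘(ℝ, E) x) :
    ∑ i, g.inner x v (frame g x i) • frame g x i = v := by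
  simp only [← frame_repr, (frame g x).sum_repr v]

/-- The chosen frames of two metrics are unrelated, so their Ricci tensors are compared through the
trace of an endomorphism, which needs no frame. -/
theorem traceAt_eq_trace (g : Metric E M) (x : M)
    (L : TangentSpace 𝓘(ℝ, E) x →ₗ[ℝ] TangentSpace 𝓘(ℝ, E) x) :
    traceAt g x (fun u u' ↦ g.inner x (L u) u') = LinearMap.trace ℝ _ L := by
  rw [LinearMap.trace_eq_matrix_trace ℝ (frame g x), traceAt, Matrix.trace]
  simp [LinearMap.toMatrix_apply, frame_repr]

theorem ric_eq_trace (g : Metric E M) (x : M) (v w : TangentSpace 𝓘(ℝ, E) x) :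
    ric g x v w = LinearMap.trace ℝ _ (curvEnd g x v w) :=
  traceAt_eq_trace g x (curvEnd g x v w)

/-- The two middle terms are exchanged by swapping `X` and `Y`. In the commutator they cancel, and
only curvature terms and the bracket remain. -/
theorem dirDeriv_dirDeriv_inner (g : Metric E M) {X Y Z W : VField E M} {x : M}
    (hY : C2At Y x) (hZ : C2At Z x) (hW : C2At W x) :
    dirDeriv X (dirDeriv Y fun y ↦ g.inner y (Z y) (W y)) x =
      g.inner x (leviCivita g (fun y ↦ leviCivita g Z y (Y y)) x (X x)) (W x)
        + g.inner x (leviCivita g Z x (Y x)) (leviCivita g W x (X x))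
        + (g.inner x (leviCivita g Z x (X x)) (leviCivita g W x (Y x))
        + g.inner x (Z x) (leviCivita g (fun y ↦ leviCivita g W y (Y y)) x (X x))) := by
  have LC := isLeviCivita_leviCivita g
  have e : (dirDeriv Y fun y ↦ g.inner y (Z y) (W y)) =ᶠ[𝓝 x]
      fun y ↦ g.inner y (leviCivita g Z y (Y y)) (W y)
        + g.inner y (Z y) (leviCivita g W y (Y y)) := by
    filter_upwards [hZ.eventually, hW.eventually] with y h1 h2
    exact LC.metric Z W y h1.diffAt h2.diffAt (Y y)
  have dZ := diffAt_leviCivita g hY hZ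
  have dW := diffAt_leviCivita g hY hW
  rw [dirDeriv, mvfderiv_congr e, mvfderiv_fun_add (mdifferentiableAt_inner g dZ hW.diffAt)
    (mdifferentiableAt_inner g hZ.diffAt dW), add_apply, LC.metric _ _ x dZ hW.diffAt,
    LC.metric _ _ x hZ.diffAt dW]

/-- `R(X, Y)` is skew-symmetric. -/
theorem inner_curv_skew (g : Metric E M) {X Y Z W : VField E M} {x : M} (hX : C2At X x)
    (hY : C2At Y x) (hZ : C2At Z x) (hW : C2At W x) :
    g.inner x (curv g X Y Z x) (W x) = - g.inner x (Z x) (curv g X Y W x) := by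
  have h := dirDeriv_comm hX hY (contMDiffAt_inner g hZ hW)
  rw [dirDeriv_dirDeriv_inner g hY hZ hW, dirDeriv_dirDeriv_inner g hX hZ hW,
    (isLeviCivita_leviCivita g).metric _ _ x hZ.diffAt hW.diffAt] at h
  simp only [curv, map_sub, sub_apply]
  linarith

/-- `R(X, Y)Z` at `x` depends on `Z` only through its value at `x`. -/
theorem curv_congr (g : Metric E M) {X Y Z Z' : VField E M} {x : M} (hX : C2At X x)
    (hY : C2At Y x) (hZ : C2At Z x) (hZ' : C2At Z' x) (h : Z x = Z' x) :
    curv g X Y Z x = curv g X Y Z' x := by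
  refine inner_ext g x fun w ↦ ?_
  have hw := c2At_extend w
  have h1 := inner_curv_skew g hX hY hZ hw
  have h2 := inner_curv_skew g hX hY hZ' hw
  rw [extend_apply_self] at h1 h2
  rw [h1, h2, h]

end Curvature

/-! ### The Hessian, its symmetry, and the Lie derivative along a gradient. -/

section Hessian

variable {E : Type*} [NormedAddCommGroup E] [NormedSpace ℝ E] [FiniteDimensional ℝ E]
  {M : Type*} [TopologicalSpace M] [ChartedSpace E M] [IsManifold 𝓘(ℝ, E) ∞ M]

theorem inner_grad (g : Metric E M) (f : M → ℝ) (x : M) (v : TangentSpace 𝓘(ℝ, E) x) :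
    g.inner x (grad g f x) v = d% f x v :=
  inner_sharp g x _ v

theorem diffAt_grad (g : Metric E M) {f : M → ℝ} {x : M}
    (hf : ContMDiffAt 𝓘(ℝ, E) 𝓘(ℝ, ℝ) 2 f x) : DiffAt (grad g f) x := by
  refine diffAt_of_inner g fun Z hZ ↦ ?_
  simp only [inner_grad]
  exact mdifferentiableAt_dirDeriv hZ hf

theorem hess_eq (g : Metric E M) {f : M → ℝ} {x : M} (hf : ContMDiffAt 𝓘(ℝ, E) 𝓘(ℝ, ℝ) 2 f x)
    {W : VField E M} (hW : DiffAt W x) (v : TangentSpace 𝓘(ℝ, E) x) :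
    hess g f x v (W x) = d% (dirDeriv W f) x v - d% f x (leviCivita g W x v) := by
  have h := (isLeviCivita_leviCivita g).metric _ _ x (diffAt_grad g hf) hW v
  simp only [inner_grad] at h
  rw [hess, eq_sub_iff_add_eq]
  exact h.symm

/-- The commutator of derivations of `f` is the bracket, which by torsion-freeness is the difference
of the two connection terms. -/
theorem hess_symm (g : Metric E M) {f : M → ℝ} {x : M} (hf : ContMDiffAt 𝓘(ℝ, E) 𝓘(ℝ, ℝ) 2 f x)
    (v w : TangentSpace 𝓘(ℝ, E) x) : hess g f x v w = hess g f x w v := by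
  have hv := c2At_extend v
  have hw := c2At_extend w
  have h1 := hess_eq g hf hw.diffAt v
  have h2 := hess_eq g hf hv.diffAt w
  have h3 := dirDeriv_comm hv hw hf
  rw [← (isLeviCivita_leviCivita g).torsion_free _ _ x hv.diffAt hw.diffAt, map_sub] at h3
  rw [dirDeriv, dirDeriv] at h3
  simp only [extend_apply_self] at h1 h2 h3
  rw [h1, h2]
  linarith

theorem lieMetric_grad (g : Metric E M) {f : M → ℝ} {x : M}
    (hf : ContMDiffAt 𝓘(ℝ, E) 𝓘(ℝ, ℝ) 2 f x) {X Y : VField E M} (hX : DiffAt X x)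
    (hY : DiffAt Y x) : lieMetric g (grad g f) X Y x = 2 * hess g f x (X x) (Y x) := by
  have LC := isLeviCivita_leviCivita g
  have hV := diffAt_grad g hf
  have hs := hess_symm g hf (X x) (Y x)
  rw [lieMetric, dirDeriv, LC.metric _ _ x hX hY, ← LC.torsion_free _ _ x hV hX,
    ← LC.torsion_free _ _ x hV hY, two_mul]
  conv_rhs => rw [hs]
  rw [hess] at hs ⊢
  rw [hess] at hs
  rw [map_sub, map_sub, sub_apply, g.symm x (X x) (leviCivita g (grad g f) x (Y x))]
  linarith

end Hessian

/-! ### The Reeb field of a Kenmotsu structure and the deformed connection. -/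

section Contact

variable {E : Type*} [NormedAddCommGroup E] [NormedSpace ℝ E] [FiniteDimensional ℝ E]
  {M : Type*} [TopologicalSpace M] [ChartedSpace E M] [IsManifold 𝓘(ℝ, E) ∞ M]

/-- The Kenmotsu and soliton equations quantify over globally smooth fields; a bump function lets
them be read at arbitrary tangent vectors. -/
theorem exists_isSmooth_eq [T2Space M] (x : M) (v : TangentSpace 𝓘(ℝ, E) x) :
    ∃ X : VField E M, IsSmooth X ∧ X x = v := by
  obtain ⟨s, hs, hsv⟩ := exists_contMDiffOn_extend (k := ∞) 𝓘(ℝ, E) E v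
  obtain ⟨ψ, hψ, -⟩ := (SmoothBumpFunction.nhds_basis_support (I := 𝓘(ℝ, E))
    (interior_mem_nhds.2 hs)).mem_iff.1 (interior_mem_nhds.2 hs)
  refine ⟨(ψ : M → ℝ) • extend E v, ?_, ?_⟩
  · exact ContMDiffOn.smul_section_of_tsupport ψ.contMDiff.contMDiffOn isOpen_interior hψ
      (hsv.mono interior_subset)
  · simp

namespace AlmostContactMetric

variable (S : AlmostContactMetric E M)

theorem φ_ξ (x : M) : S.φ x (S.ξ x) = 0 := by
  by_contra h
  have h2 := S.g.pos x _ h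
  rw [S.inner_φ, ← S.η_eq, S.η_ξ] at h2
  norm_num at h2

/-- The transverse part `g - η ⊗ η` of the metric. -/
noncomputable def transverse (x : M) (v w : TangentSpace 𝓘(ℝ, E) x) : ℝ := S.g.inner x v w - S.η x v * S.η x w

theorem transverse_symm (x : M) (v w : TangentSpace 𝓘(ℝ, E) x) :
    S.transverse x v w = S.transverse x w v := by
  rw [transverse, transverse, S.g.symm x v w, mul_comm]

theorem transverse_ξ (x : M) (v : TangentSpace 𝓘(ℝ, E) x) : S.transverse x v (S.ξ x) = 0 := by
  rw [transverse, S.g.symm, ← S.η_eq, S.η_ξ, mul_one, sub_self]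

variable {S}

/-- The covariant derivative of the Reeb field of a Kenmotsu manifold. -/
theorem IsKenmotsu.nabla_ξ [T2Space M] (hS : S.IsKenmotsu) (x : M) (v : TangentSpace 𝓘(ℝ, E) x) :
    leviCivita S.g S.ξ x v = v - S.η x v • S.ξ x := by
  obtain ⟨X, hX, rfl⟩ := exists_isSmooth_eq x v
  have hξ := (S.smooth_ξ.c2At x).diffAt
  have h := hS X S.ξ hX S.smooth_ξ x
  have h0 : (fun y ↦ S.φ y (S.ξ y)) = (0 : VField E M) := funext fun y ↦ S.φ_ξ y
  have h1 : S.g.inner x (S.φ x (X x)) (S.ξ x) = 0 := by rw [S.g.symm, ← S.η_eq, S.η_φ]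
  rw [h0, CovariantDerivative.zero, h1, S.η_ξ] at h
  have h2 : S.φ x (leviCivita S.g S.ξ x (X x)) = S.φ x (X x) := by simpa using h
  -- The identity `φ(∇_X ξ) = φ X` fixes `∇_X ξ` only up to a multiple of `ξ`; the unit length of
  -- `ξ` fixes that multiple.
  have h3 : S.η x (leviCivita S.g S.ξ x (X x)) = 0 := by
    have h4 := (isLeviCivita_leviCivita S.g).metric _ _ x hξ hξ (X x)
    have h5 : (fun y ↦ S.g.inner y (S.ξ y) (S.ξ y)) = fun _ ↦ (1 : ℝ) := by
      ext y; rw [← S.η_eq, S.η_ξ]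
    rw [h5, mvfderiv_const, S.g.symm x (leviCivita S.g S.ξ x (X x)), ← S.η_eq] at h4
    simp only [zero_apply] at h4
    linarith
  have h6 := congrArg (S.φ x) h2
  rw [S.φ_sq, S.φ_sq, h3, zero_smul, add_zero, neg_eq_iff_eq_neg] at h6
  rw [h6]
  abel

theorem mdifferentiableAt_η (S : AlmostContactMetric E M) {Y : VField E M} {x : M}
    (hY : DiffAt Y x) : MDifferentiableAt 𝓘(ℝ, E) 𝓘(ℝ, ℝ) (fun y ↦ S.η y (Y y)) x := by
  simp only [S.η_eq]
  exact mdifferentiableAt_inner S.g (S.smooth_ξ.c2At x).diffAt hY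

/-- In tensor form this is `∇η = T`, with `T` the transverse part of the metric; its symmetry is
what simplifies the deformed Koszul formula. -/
theorem IsKenmotsu.mvfderiv_η [T2Space M] (hS : S.IsKenmotsu) {Y : VField E M} {x : M} (hY : DiffAt Y x)
    (v : TangentSpace 𝓘(ℝ, E) x) :
    d% (fun y ↦ S.η y (Y y)) x v = S.transverse x v (Y x) + S.η x (leviCivita S.g Y x v) := by
  have h := (isLeviCivita_leviCivita S.g).metric _ _ x (S.smooth_ξ.c2At x).diffAt hY v
  simp only [← S.η_eq] at h
  rw [h, hS.nabla_ξ, transverse]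
  simp [← S.η_eq]

theorem deformMetric_inner (a : ℝ) (ha : 0 < a) (x : M) (v w : TangentSpace 𝓘(ℝ, E) x) :
    (S.deformMetric a ha).inner x v w =
      a * S.g.inner x v w + a * (a - 1) * (S.η x v * S.η x w) := by
  simp [deformMetric]

variable [T2Space M]

theorem IsKenmotsu.mvfderiv_deform_inner (hS : S.IsKenmotsu) (a : ℝ) (ha : 0 < a)
    {Y Z : VField E M} {x : M} (hY : DiffAt Y x) (hZ : DiffAt Z x) (v : TangentSpace 𝓘(ℝ, E) x) :
    d% (fun y ↦ (S.deformMetric a ha).inner y (Y y) (Z y)) x v =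
      a * (S.g.inner x (leviCivita S.g Y x v) (Z x) + S.g.inner x (Y x) (leviCivita S.g Z x v))
        + a * (a - 1) * ((S.transverse x v (Y x) + S.η x (leviCivita S.g Y x v)) * S.η x (Z x)
          + S.η x (Y x) * (S.transverse x v (Z x) + S.η x (leviCivita S.g Z x v))) := by
  simp only [deformMetric_inner]
  have h1 := mdifferentiableAt_inner S.g hY hZ
  have h2 := S.mdifferentiableAt_η hY
  have h3 := S.mdifferentiableAt_η hZ
  have h4 : MDifferentiableAt 𝓘(ℝ, E) 𝓘(ℝ, ℝ) (fun y ↦ S.η y (Y y) * S.η y (Z y)) x := h2.mul h3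
  have h5 : MDifferentiableAt 𝓘(ℝ, E) 𝓘(ℝ, ℝ) (fun y ↦ a * S.g.inner y (Y y) (Z y)) x :=
    mdifferentiableAt_const.mul h1
  have h6 : MDifferentiableAt 𝓘(ℝ, E) 𝓘(ℝ, ℝ)
      (fun y ↦ a * (a - 1) * (S.η y (Y y) * S.η y (Z y))) x := mdifferentiableAt_const.mul h4
  rw [mvfderiv_fun_add h5 h6, mvfderiv_fun_mul mdifferentiableAt_const h1,
    mvfderiv_fun_mul mdifferentiableAt_const h4, mvfderiv_const, mvfderiv_const,
    mvfderiv_fun_mul h2 h3]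
  simp [hS.mvfderiv_η hY, hS.mvfderiv_η hZ, (isLeviCivita_leviCivita S.g).metric _ _ x hY hZ]
  ring

/-- The Levi-Civita connection of a `D`-homothetic deformation. -/
theorem IsKenmotsu.deform_nabla (hS : S.IsKenmotsu) (a : ℝ) (ha : 0 < a)
    {Y : VField E M} {x : M} (hY : DiffAt Y x) (v : TangentSpace 𝓘(ℝ, E) x) :
    leviCivita (S.deformMetric a ha) Y x v =
      leviCivita S.g Y x v + ((a - 1) / a * S.transverse x v (Y x)) • S.ξ x := by
  have LC := isLeviCivita_leviCivita S.g
  refine inner_ext (S.deformMetric a ha) x fun w ↦ ?_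
  have hv := diffAt_extend v
  have hw := diffAt_extend w
  have h := inner_koszulNabla (S.deformMetric a ha) hv hY hw
  -- With all derivatives and brackets written through `∇`, the symmetric `∇η` terms leave only `a
  -- (a - 1) T(v, Y) η(w)` after halving. Since `ḡ(ξ, w) = a² η(w)`, the correction is `(a - 1) / a`
  -- times `T(v, Y) ξ`.
  simp only [koszul, hS.mvfderiv_deform_inner a ha hv hY, hS.mvfderiv_deform_inner a ha hv hw,
    hS.mvfderiv_deform_inner a ha hY hw, ← LC.torsion_free _ _ x hv hY,
    ← LC.torsion_free _ _ x hv hw, ← LC.torsion_free _ _ x hY hw] at h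
  rw [extend_apply_self, extend_apply_self] at h
  refine h.trans ?_
  have e1 := fun (Z : VField E M) u ↦ S.g.symm x v (leviCivita S.g Z x u)
  have e2 := fun (Z : VField E M) u ↦ S.g.symm x (Y x) (leviCivita S.g Z x u)
  simp only [deformMetric_inner, map_sub, map_add, map_smul, sub_apply, add_apply,
    smul_apply, smul_eq_mul, S.η_ξ, ← S.η_eq, e1, e2, S.transverse_symm x (Y x) v,
    S.transverse_symm x w v, S.transverse_symm x w (Y x)]
  field_simp
  ring

end AlmostContactMetric

end Contact

/-! ### Curvature, Ricci tensor and Hessian under the deformation. -/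

section Deformation

variable {E : Type*} [NormedAddCommGroup E] [NormedSpace ℝ E] [FiniteDimensional ℝ E]
  {M : Type*} [TopologicalSpace M] [ChartedSpace E M] [IsManifold 𝓘(ℝ, E) ∞ M]

namespace AlmostContactMetric

variable {S : AlmostContactMetric E M}

theorem transverse_add_right (x : M) (u v w : TangentSpace 𝓘(ℝ, E) x) :
    S.transverse x u (v + w) = S.transverse x u v + S.transverse x u w := by
  simp only [transverse, map_add]
  ring

theorem transverse_smul_right (c : ℝ) (x : M) (u v : TangentSpace 𝓘(ℝ, E) x) :
    S.transverse x u (c • v) = c * S.transverse x u v := by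
  simp only [transverse, map_smul, smul_eq_mul]
  ring

theorem transverse_sub_left (x : M) (u v w : TangentSpace 𝓘(ℝ, E) x) :
    S.transverse x (u - v) w = S.transverse x u w - S.transverse x v w := by
  simp only [transverse, map_sub, sub_apply]
  ring

theorem mdifferentiableAt_transverse (S : AlmostContactMetric E M) {Y Z : VField E M} {x : M}
    (hY : DiffAt Y x) (hZ : DiffAt Z x) :
    MDifferentiableAt 𝓘(ℝ, E) 𝓘(ℝ, ℝ) (fun y ↦ S.transverse y (Y y) (Z y)) x :=
  (mdifferentiableAt_inner S.g hY hZ).sub ((S.mdifferentiableAt_η hY).mul (S.mdifferentiableAt_η hZ))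

variable [T2Space M]

/-- As `∇g = 0`, the last two terms come from differentiating the two factors of `η ⊗ η`. -/
theorem IsKenmotsu.mvfderiv_transverse (hS : S.IsKenmotsu) {Y Z : VField E M} {x : M}
    (hY : DiffAt Y x) (hZ : DiffAt Z x) (v : TangentSpace 𝓘(ℝ, E) x) :
    d% (fun y ↦ S.transverse y (Y y) (Z y)) x v =
      S.transverse x (leviCivita S.g Y x v) (Z x) + S.transverse x (Y x) (leviCivita S.g Z x v)
        - S.transverse x v (Y x) * S.η x (Z x) - S.η x (Y x) * S.transverse x v (Z x) := by
  have h2 := S.mdifferentiableAt_η hY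
  have h3 := S.mdifferentiableAt_η hZ
  have h4 : MDifferentiableAt 𝓘(ℝ, E) 𝓘(ℝ, ℝ) (fun y ↦ S.η y (Y y) * S.η y (Z y)) x := h2.mul h3
  have e : (fun y ↦ S.transverse y (Y y) (Z y)) =
      fun y ↦ S.g.inner y (Y y) (Z y) - S.η y (Y y) * S.η y (Z y) := rfl
  rw [e, mvfderiv_fun_sub (mdifferentiableAt_inner S.g hY hZ) h4, mvfderiv_fun_mul h2 h3]
  simp only [sub_apply, add_apply, smul_apply, smul_eq_mul, hS.mvfderiv_η hY, hS.mvfderiv_η hZ,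
    (isLeviCivita_leviCivita S.g).metric _ _ x hY hZ]
  simp only [transverse]
  ring

theorem IsKenmotsu.deform_nabla_nabla (hS : S.IsKenmotsu) (a : ℝ) (ha : 0 < a)
    {X Y Z : VField E M} {x : M} (hY : C2At Y x) (hZ : C2At Z x) :
    leviCivita (S.deformMetric a ha) (fun y ↦ leviCivita (S.deformMetric a ha) Z y (Y y)) x (X x) =
      leviCivita S.g (fun y ↦ leviCivita S.g Z y (Y y)) x (X x)
        + ((a - 1) / a * S.transverse x (Y x) (Z x)) • (X x - S.η x (X x) • S.ξ x)
        + ((a - 1) / a * (S.transverse x (X x) (leviCivita S.g Z x (Y x))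
          + S.transverse x (leviCivita S.g Y x (X x)) (Z x)
          + S.transverse x (Y x) (leviCivita S.g Z x (X x))
          - S.transverse x (X x) (Y x) * S.η x (Z x)
          - S.η x (Y x) * S.transverse x (X x) (Z x))) • S.ξ x := by
  have hξ := (S.smooth_ξ.c2At x).diffAt
  have h0 := diffAt_leviCivita S.g hY hZ
  have h1 := S.mdifferentiableAt_transverse hY.diffAt hZ.diffAt
  let h : M → ℝ := fun y ↦ (a - 1) / a * S.transverse y (Y y) (Z y)
  have hh : MDifferentiableAt 𝓘(ℝ, E) 𝓘(ℝ, ℝ) h x := mdifferentiableAt_const.mul h1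
  have hdh : d% h x (X x) = (a - 1) / a * d% (fun y ↦ S.transverse y (Y y) (Z y)) x (X x) := by
    change d% (fun y ↦ (a - 1) / a * S.transverse y (Y y) (Z y)) x (X x) = _
    rw [mvfderiv_fun_mul mdifferentiableAt_const h1, mvfderiv_const]
    simp
  have e : (fun y ↦ leviCivita (S.deformMetric a ha) Z y (Y y)) =ᶠ[𝓝 x]
      (fun y ↦ leviCivita S.g Z y (Y y)) + h • S.ξ := by
    filter_upwards [hZ.eventually] with y hZy
    exact hS.deform_nabla a ha hZy.diffAt (Y y)
  have hd : DiffAt ((fun y ↦ leviCivita S.g Z y (Y y)) + h • S.ξ) x :=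
    mdifferentiableAt_add_section h0 (hh.smul_section hξ)
  rw [leviCivita_congr _ (diffAt_leviCivita _ hY hZ) e, hS.deform_nabla a ha hd,
    leviCivita_add S.g h0 (hh.smul_section hξ), leviCivita_smul S.g hξ hh, hS.nabla_ξ, hdh,
    hS.mvfderiv_transverse hY.diffAt hZ.diffAt, Pi.add_apply, Pi.smul_apply',
    transverse_add_right, transverse_smul_right, transverse_ξ]
  simp only [h]
  module

/-- The curvature of a `D`-homothetic deformation of a Kenmotsu manifold. -/
theorem IsKenmotsu.deform_curv (hS : S.IsKenmotsu) (a : ℝ) (ha : 0 < a)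
    {X Y Z : VField E M} {x : M} (hX : C2At X x) (hY : C2At Y x) (hZ : C2At Z x) :
    curv (S.deformMetric a ha) X Y Z x = curv S.g X Y Z x
      + ((a - 1) / a * S.transverse x (Y x) (Z x)) • X x
      - ((a - 1) / a * S.transverse x (X x) (Z x)) • Y x := by
  rw [curv, curv, hS.deform_nabla_nabla a ha hY hZ, hS.deform_nabla_nabla a ha hX hZ,
    hS.deform_nabla a ha hZ.diffAt,
    ← (isLeviCivita_leviCivita S.g).torsion_free _ _ x hX.diffAt hY.diffAt, transverse_sub_left,
    S.transverse_symm x (Y x) (X x)]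
  -- All components along `ξ` cancel: the part `-η(X) ξ` of `∇_X ξ` is compensated by the `∇T` term
  -- with `X` and `Y` exchanged.
  module

/-- The Ricci tensor of a `D`-homothetic deformation of a Kenmotsu manifold. -/
theorem IsKenmotsu.deform_ric (hS : S.IsKenmotsu) (a : ℝ) (ha : 0 < a) (x : M)
    (v w : TangentSpace 𝓘(ℝ, E) x) :
    ric (S.deformMetric a ha) x v w =
      ric S.g x v w + (finrank ℝ E - 1) * ((a - 1) / a) * S.transverse x v w := by
  let l : TangentSpace 𝓘(ℝ, E) x →ₗ[ℝ] ℝ := (S.g.inner x w - S.η x w • S.η x).toLinearMap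
  have hl : ∀ u, l u = S.transverse x u w := fun u ↦ by
    rw [S.transverse_symm]
    simp [l, transverse]
  -- The correction is a multiple of the identity minus a rank-one map; their traces combine to the
  -- factor `finrank ℝ E - 1`.
  have h : curvEnd (S.deformMetric a ha) x v w = curvEnd S.g x v w
      + ((a - 1) / a * S.transverse x v w) • LinearMap.id - ((a - 1) / a) • l.smulRight v := by
    ext u
    have := hS.deform_curv a ha (c2At_extend u) (c2At_extend v) (c2At_extend w)
    simp only [extend_apply_self] at this
    simp only [curvEnd, LinearMap.coe_mk, AddHom.coe_mk, this, LinearMap.sub_apply,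
      LinearMap.add_apply, LinearMap.smul_apply, LinearMap.id_apply, LinearMap.smulRight_apply, hl,
      smul_smul]
  have hfr : finrank ℝ (TangentSpace 𝓘(ℝ, E) x) = finrank ℝ E := rfl
  have : FiniteDimensional ℝ (TangentSpace 𝓘(ℝ, E) x) := inferInstanceAs (FiniteDimensional ℝ E)
  rw [ric_eq_trace, ric_eq_trace, h, map_sub, map_add, map_smul, map_smul, LinearMap.trace_id,
    LinearMap.trace_smulRight, hl, hfr, smul_eq_mul, smul_eq_mul]
  ring

theorem IsKenmotsu.nabla_nabla_ξ (hS : S.IsKenmotsu) {X Y : VField E M} {x : M}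
    (hY : DiffAt Y x) :
    leviCivita S.g (fun y ↦ leviCivita S.g S.ξ y (Y y)) x (X x) =
      leviCivita S.g Y x (X x) - S.η x (Y x) • (X x - S.η x (X x) • S.ξ x)
        - (S.transverse x (X x) (Y x) + S.η x (leviCivita S.g Y x (X x))) • S.ξ x := by
  have hξ := (S.smooth_ξ.c2At x).diffAt
  have hη := S.mdifferentiableAt_η hY
  have e : (fun y ↦ leviCivita S.g S.ξ y (Y y)) = Y + (-1 : ℝ) • (fun y ↦ S.η y (Y y)) • S.ξ := by
    ext1 y
    rw [hS.nabla_ξ, Pi.add_apply, Pi.smul_apply, Pi.smul_apply']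
    module
  have h1 : DiffAt ((fun y ↦ S.η y (Y y)) • S.ξ) x := hη.smul_section hξ
  have h2 : DiffAt ((-1 : ℝ) • (fun y ↦ S.η y (Y y)) • S.ξ) x :=
    mdifferentiableAt_const.smul_section (f := fun _ ↦ (-1 : ℝ)) h1
  rw [e, leviCivita_add S.g hY h2, leviCivita_const_smul S.g _ h1, leviCivita_smul S.g hξ hη,
    hS.nabla_ξ, hS.mvfderiv_η hY]
  module

theorem IsKenmotsu.curv_ξ (hS : S.IsKenmotsu) {X Y : VField E M} {x : M}
    (hX : DiffAt X x) (hY : DiffAt Y x) :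
    curv S.g X Y S.ξ x = S.η x (X x) • Y x - S.η x (Y x) • X x := by
  rw [curv, hS.nabla_nabla_ξ hY, hS.nabla_nabla_ξ hX, hS.nabla_ξ,
    ← (isLeviCivita_leviCivita S.g).torsion_free _ _ x hX hY, S.transverse_symm x (Y x) (X x),
    map_sub]
  module

theorem IsKenmotsu.ric_ξ (hS : S.IsKenmotsu) (x : M) :
    ric S.g x (S.ξ x) (S.ξ x) = -(finrank ℝ E - 1) := by
  have h : curvEnd S.g x (S.ξ x) (S.ξ x) =
      (S.η x).toLinearMap.smulRight (S.ξ x) - LinearMap.id := by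
    ext u
    have hu := c2At_extend u
    have hξ := c2At_extend (S.ξ x)
    -- Ricci is defined with an extension of the vector `ξ x`; tensoriality in the third slot allows
    -- the actual field `ξ`, to which `curv_ξ` applies.
    have h1 := curv_congr S.g hu hξ hξ (S.smooth_ξ.c2At x) (extend_apply_self E (S.ξ x))
    have h2 := hS.curv_ξ hu.diffAt hξ.diffAt
    rw [extend_apply_self, extend_apply_self, S.η_ξ, one_smul] at h2
    exact h1.trans h2
  have hfr : finrank ℝ (TangentSpace 𝓘(ℝ, E) x) = finrank ℝ E := rfl
  have : FiniteDimensional ℝ (TangentSpace 𝓘(ℝ, E) x) := inferInstanceAs (FiniteDimensional ℝ E)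
  rw [ric_eq_trace, h, map_sub, LinearMap.trace_smulRight, LinearMap.trace_id, hfr]
  simp [S.η_ξ]

theorem IsKenmotsu.deform_hess (hS : S.IsKenmotsu) (a : ℝ) (ha : 0 < a) {f : M → ℝ} {x : M}
    (hf : ContMDiffAt 𝓘(ℝ, E) 𝓘(ℝ, ℝ) 2 f x) (v w : TangentSpace 𝓘(ℝ, E) x) :
    hess (S.deformMetric a ha) f x v w =
      hess S.g f x v w - (a - 1) / a * S.transverse x v w * dirDeriv S.ξ f x := by
  have hw := diffAt_extend w
  have h1 := hess_eq S.g hf hw v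
  have h2 := hess_eq (S.deformMetric a ha) hf hw v
  rw [extend_apply_self] at h1 h2
  rw [h1, h2, hS.deform_nabla a ha hw, extend_apply_self, map_add, map_smul, dirDeriv, smul_eq_mul]
  ring

/-- The first-order term disappears because `∇_ξ ξ = 0`. -/
theorem IsKenmotsu.hess_ξ (hS : S.IsKenmotsu) {f : M → ℝ} {x : M}
    (hf : ContMDiffAt 𝓘(ℝ, E) 𝓘(ℝ, ℝ) 2 f x) :
    hess S.g f x (S.ξ x) (S.ξ x) = dirDeriv S.ξ (dirDeriv S.ξ f) x := by
  rw [hess_eq S.g hf (S.smooth_ξ.c2At x).diffAt, hS.nabla_ξ, S.η_ξ, one_smul, sub_self, map_zero,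
    sub_zero, dirDeriv]

/-- The Ricci tensor of a Kenmotsu manifold with a deformed gradient almost Ricci soliton. -/
theorem IsKenmotsu.ric_of_soliton (hS : S.IsKenmotsu) (a : ℝ) (ha : 0 < a) {f lam : M → ℝ}
    (hf : ContMDiff 𝓘(ℝ, E) 𝓘(ℝ, ℝ) ∞ f)
    (hsol : IsAlmostRicciSoliton (S.deform a ha).g (grad (S.deform a ha).g f) lam) (x : M)
    (v w : TangentSpace 𝓘(ℝ, E) x) :
    ric S.g x v w = - hess S.g f x v w
      + ((a - 1) / a * (dirDeriv S.ξ f x - (finrank ℝ E - 1)) + a * lam x) * S.g.inner x v w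
      + (a * (a - 1) * lam x - (a - 1) / a * (dirDeriv S.ξ f x - (finrank ℝ E - 1)))
        * (S.η x v * S.η x w) := by
  have hf2 : ContMDiffAt 𝓘(ℝ, E) 𝓘(ℝ, ℝ) 2 f x := (hf x).of_le two_le_infty
  obtain ⟨X, hX, rfl⟩ := exists_isSmooth_eq x v
  obtain ⟨Y, hY, rfl⟩ := exists_isSmooth_eq x w
  have h := hsol.equation X Y hX hY x
  change 1 / 2 * lieMetric (S.deformMetric a ha) (grad (S.deformMetric a ha) f) X Y x
    + ric (S.deformMetric a ha) x (X x) (Y x)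
    = lam x * (S.deformMetric a ha).inner x (X x) (Y x) at h
  rw [lieMetric_grad _ hf2 (hX.c2At x).diffAt (hY.c2At x).diffAt, hS.deform_ric,
    hS.deform_hess a ha hf2, deformMetric_inner, transverse] at h
  linear_combination h

end AlmostContactMetric

end Deformation

/-! ### Trace and norm of `-H + u I + b c ⊗ c` for a unit vector `c`. -/

section Sums

variable {m : ℕ} {H R : Fin m → Fin m → ℝ} {c : Fin m → ℝ} {u b : ℝ}

theorem sum_diag_of_eq (hc : ∑ i, c i ^ 2 = 1)
    (hR : ∀ i j, R i j = - H i j + u * (if i = j then 1 else 0) + b * (c i * c j)) :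
    ∑ i, R i i = - ∑ i, H i i + u * m + b := by
  have h : ∀ i, R i i = - H i i + u + b * c i ^ 2 := fun i ↦ by rw [hR, if_pos rfl]; ring
  simp only [h, Finset.sum_add_distrib, ← Finset.mul_sum, hc, Finset.sum_neg_distrib]
  simp [mul_comm]

theorem sum_sq_of_eq (hc : ∑ i, c i ^ 2 = 1)
    (hR : ∀ i j, R i j = - H i j + u * (if i = j then 1 else 0) + b * (c i * c j)) :
    ∑ i, ∑ j, R i j ^ 2 = ∑ i, ∑ j, H i j ^ 2 - 2 * u * ∑ i, H i i
      - 2 * b * ∑ i, ∑ j, c i * c j * H i j + u ^ 2 * m + 2 * u * b + b ^ 2 := by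
  have h : ∀ i j, R i j ^ 2 = H i j ^ 2 - 2 * b * (c i * c j * H i j) + b ^ 2 * (c i ^ 2 * c j ^ 2)
      + (if i = j then u ^ 2 - 2 * u * H i i + 2 * u * b * c i ^ 2 else 0) := by
    intro i j
    rw [hR]
    split_ifs with hij
    · subst hij; ring
    · ring
  simp only [h, Finset.sum_add_distrib, Finset.sum_sub_distrib, ← Finset.mul_sum, hc,
    Finset.sum_ite_eq, Finset.mem_univ, if_true]
  simp [mul_comm, hc]
  ring

end Sums

/-! ### The Reeb field in an orthonormal frame. -/

section Frame

variable {E : Type*} [NormedAddCommGroup E] [NormedSpace ℝ E] [FiniteDimensional ℝ E]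
  {M : Type*} [TopologicalSpace M] [ChartedSpace E M] [IsManifold 𝓘(ℝ, E) ∞ M]

theorem AlmostContactMetric.sum_η_smul_frame (S : AlmostContactMetric E M) (x : M) :
    ∑ i, S.η x (frame S.g x i) • frame S.g x i = S.ξ x := by
  simp only [S.η_eq, sum_inner_frame_smul]

theorem AlmostContactMetric.sum_sq_η (S : AlmostContactMetric E M) (x : M) :
    ∑ i, S.η x (frame S.g x i) ^ 2 = 1 := by
  have h := congrArg (S.η x) (S.sum_η_smul_frame x)
  rw [S.η_ξ, map_sum] at h
  simpa [sq] using h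

theorem AlmostContactMetric.sum_η_hess (S : AlmostContactMetric E M) (f : M → ℝ) (x : M) :
    ∑ i, ∑ j, S.η x (frame S.g x i) * S.η x (frame S.g x j) *
      hess S.g f x (frame S.g x i) (frame S.g x j) = hess S.g f x (S.ξ x) (S.ξ x) := by
  simp only [hess]
  conv_rhs => rw [← S.sum_η_smul_frame x]
  simp only [map_sum, map_smul, sum_apply, smul_apply, smul_eq_mul, Finset.mul_sum]
  rw [Finset.sum_comm]
  refine Finset.sum_congr rfl fun i _ ↦ Finset.sum_congr rfl fun j _ ↦ ?_
  ring

end Frame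

end Kenmotsu

theorem mainTheorem10 (n : ℕ) {M : Type*} [TopologicalSpace M] [T2Space M]
    [ChartedSpace (EuclideanSpace ℝ (Fin (2 * n + 1))) M] [IsManifold (𝓡 (2 * n + 1)) ∞ M]
    (S : AlmostContactMetric (EuclideanSpace ℝ (Fin (2 * n + 1))) M) (hS : S.IsKenmotsu)
    (a : ℝ) (ha : 0 < a) (f : M → ℝ) (hf : ContMDiff (𝓡 (2 * n + 1)) 𝓘(ℝ, ℝ) ∞ f)
    (lam : M → ℝ)
    (hsol : IsAlmostRicciSoliton (S.deform a ha).g (grad (S.deform a ha).g f) lam) (x : M) :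
    normSqAt S.g x (ric S.g x) ≥
      normSqAt S.g x (hess S.g f x)
        - 4 * n * ((a - 1) / a) * scal S.g x
        - 4 * n ^ 2 * (2 * n + 1) * ((a - 1) / a) ^ 2
        - 1 / (2 * n + 1) * laplacian S.g f x ^ 2
        - 2 / (2 * n + 1) * ((a - 1) / a) *
            (dirDeriv S.ξ f x - dirDeriv S.ξ (dirDeriv S.ξ f) x) * laplacian S.g f x
        + 2 * (2 * n + a) * (a - 1) / ((2 * n + 1) * a ^ 2) *
            (dirDeriv S.ξ f x * dirDeriv S.ξ (dirDeriv S.ξ f) x)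
        + 2 * n / (2 * n + 1) * ((a - 1) / a) ^ 2 * dirDeriv S.ξ f x ^ 2
        - 2 * (n + n * a + a) * (a - 1) / ((2 * n + 1) * a ^ 2) *
            dirDeriv S.ξ (dirDeriv S.ξ f) x ^ 2 := by
  have hdim : (finrank ℝ (EuclideanSpace ℝ (Fin (2 * n + 1))) : ℝ) = 2 * n + 1 := by
    simp
  have hric := hS.ric_of_soliton a ha hf hsol x
  have hξξ := hric (S.ξ x) (S.ξ x)
  rw [hS.ric_ξ, hS.hess_ξ ((hf x).of_le two_le_infty), ← S.η_eq, S.η_ξ] at hξξ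
  simp only [hdim] at hric hξξ
  have hfr : ∀ i j, ric S.g x (frame S.g x i) (frame S.g x j) =
      - hess S.g f x (frame S.g x i) (frame S.g x j)
      + ((a - 1) / a * (dirDeriv S.ξ f x - (2 * n + 1 - 1)) + a * lam x) * (if i = j then 1 else 0)
      + (a * (a - 1) * lam x - (a - 1) / a * (dirDeriv S.ξ f x - (2 * n + 1 - 1)))
        * (S.η x (frame S.g x i) * S.η x (frame S.g x j)) := fun i j ↦ by
    rw [hric, inner_frame]
  have hnorm := sum_sq_of_eq (S.sum_sq_η x) hfr
  have hscal := sum_diag_of_eq (S.sum_sq_η x) hfr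
  rw [S.sum_η_hess, hS.hess_ξ ((hf x).of_le two_le_infty), hdim] at hnorm
  rw [hdim] at hscal
  change normSqAt S.g x (ric S.g x) = normSqAt S.g x (hess S.g f x)
    - 2 * _ * laplacian S.g f x - _ + _ + _ + _ at hnorm
  change scal S.g x = - laplacian S.g f x + _ + _ at hscal
  -- On `(ξ, ξ)` the coefficients of `g` and `η ⊗ η` add up to `a² lam x`, everything else in them
  -- cancelling, so `-2n = -ξ(ξ(f)) + a² lam x`.
  have hlam : lam x = (dirDeriv S.ξ (dirDeriv S.ξ f) x - 2 * n) / a ^ 2 := by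
    rw [eq_div_iff (by positivity)]
    linear_combination -hξξ
  rw [hlam] at hnorm hscal
  rw [hnorm, hscal]
  generalize normSqAt S.g x (hess S.g f x) = h
  generalize dirDeriv S.ξ (dirDeriv S.ξ f) x = q
  generalize dirDeriv S.ξ f x = p
  generalize laplacian S.g f x = D
  rw [ge_iff_le, ← sub_nonneg]
  have hm : (0 : ℝ) < 2 * n + 1 := by positivity
  -- The base is found by completing the square in `D`: the difference of the two sides contains `D²
  -- / (2n + 1)`, and the terms linear in `D` dictate the rest. Nothing is left over.
  refine le_of_le_of_eq (b := (D - (a - 1) / a * p * (2 * n)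
    - q * (2 * n + 1 - (a - 1) / a * (2 * n)) + (2 * n + 1) * (2 * n) / a) ^ 2 / (2 * n + 1))
    (by positivity) ?_
  field_simp
  ring
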